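/- A collection of hypermaps on a finite set $X$ of $n$ points is a pair $(\sigma,\alpha)$ of permutations of $X$; it is a hypermap if the group $\langle\sigma,\alpha\rangle$ is transitive on $X$. Let $z(\pi)$ denote the number of cycles of a permutation $\pi$, fixed points included. The genus $g(\sigma,\alpha)$ of a hypermap is given by $n+2-2g(\sigma,\alpha)=z(\sigma)+z(\alpha)+z(\alpha^{-1}\sigma)$. A permutation $\theta$ is a refinement of $\gamma$ if $\theta$ maps the set of points of each cycle of $\gamma$ to itself and, for each cycle $\gamma_i$ of $\gamma$, the restriction $\theta_i$ of $\theta$ to the points of $\gamma_i$ satisfies $g(\theta_i,\gamma_i)=0$. A spanning hypertree of a hypermap $(\sigma,\alpha)$ is a hypermap $(\sigma,\theta)$ such that $\theta$ is a refinement of $\alpha$, $z(\theta^{-1}\sigma)=1$ and $g(\sigma,\theta)=0$. The reciprocal of $(\sigma,\alpha)$ is $(\alpha,\sigma)$. For $m\ge 0$ let $(\sigma_m,\alpha_m)$ be the ladder map with $m$ bounded faces. Its underlying graph has the vertices $(i,r)$ with $0\le i\le m$ and $r\in\{0,1\}$, the vertical edges joining $(i,0)$ and $(i,1)$ for $0\le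 i\le m$, and the horizontal edges joining $(i,r)$ and $(i+1,r)$ for $0\le i<m$ and $r\in\{0,1\}$, drawn in the plane with straight edges. Its points are the $6m+2$ half-edges; $\sigma_m$ sends each half-edge to the next one counterclockwise around its vertex, and $\alpha_m$ exchanges the two halves of each edge. **Theorem.** Let $T(m)$ be the number of spanning hypertrees of the reciprocal $(\alpha_m,\sigma_m)$ of $(\sigma_m,\alpha_m)$. Then, as formal power series, $$\sum_{m\ge 0} T(m)\,x^m=\frac{(1-2x)^2}{1-8x+8x^2}.$$ -/

import Mathlib

open Equiv

/-- A collection of hypermaps on the point set `X`: a pair of permutations of `X`. -/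
structure HypermapCollection (X : Type*) where
  σ : Perm X
  α : Perm X

/-- The number `z(π)` of cycles of `π`, fixed points included. -/
noncomputable def numCycles {X : Type*} (π : Perm X) : ℕ :=
  Nat.card (Quotient (Perm.SameCycle.setoid π))

namespace HypermapCollection

variable {X : Type*}

/-- The number `κ(σ, α)` of connected components: orbits of the group generated by `σ`, `α`. -/
noncomputable def numComponents (H : HypermapCollection X) : ℕ :=
  Nat.card (MulAction.orbitRel.Quotient (Subgroup.closure ({H.σ, H.α} : Set (Perm X))) X)

/-- A hypermap is a connected collection of hypermaps. -/
def IsHypermap (H : HypermapCollection X) : Prop :=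
  H.numComponents = 1

/-- The faces are the cycles of `α⁻¹σ`. -/
noncomputable def numFaces (H : HypermapCollection X) : ℕ :=
  numCycles (H.α⁻¹ * H.σ)

/-- The genus, determined by `n + 2 - 2g = z(σ) + z(α) + z(α⁻¹σ)` when `(σ, α)` is a hypermap on
`n` points. On a collection of `κ` hypermaps it is the sum of the genera of the components,
whence the summand `2κ` in place of `2`. -/
noncomputable def genus (H : HypermapCollection X) : ℚ :=
  ((Nat.card X : ℚ) + 2 * H.numComponents - numCycles H.σ - numCycles H.α - H.numFaces) / 2

/-- The reciprocal `(α, σ)` of `(σ, α)`. -/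
def reciprocal (H : HypermapCollection X) : HypermapCollection X where
  σ := H.α
  α := H.σ

end HypermapCollection

/-- `θ` is a refinement of `γ`: for every cycle of `γ`, here the cycle through `x`, the
permutation `θ` maps the set of points of the cycle to itself, and the restrictions of `θ` and
`γ` to that set form a hypermap of genus zero. -/
def IsRefinement {X : Type*} (θ γ : Perm X) : Prop :=
  ∀ x : X, ∃ h : ∀ y, γ.SameCycle x (θ y) ↔ γ.SameCycle x y,
    (HypermapCollection.mk (θ.subtypePerm h)
      (γ.subtypePerm fun _ => Perm.sameCycle_apply_right)).genus = 0

namespace HypermapCollection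

variable {X : Type*}

/-- `(σ, θ)` is a spanning hypertree of `(σ, α)`: `θ` refines `α`, and `(σ, θ)` is a hypermap
that is unicellular and has genus zero. -/
def IsSpanningHypertree (H : HypermapCollection X) (θ : Perm X) : Prop :=
  IsRefinement θ H.α ∧ (mk H.σ θ).IsHypermap ∧ (mk H.σ θ).numFaces = 1 ∧ (mk H.σ θ).genus = 0

/-- The number of spanning hypertrees. -/
noncomputable def numSpanningHypertrees (H : HypermapCollection X) : ℕ :=
  Nat.card {θ : Perm X // H.IsSpanningHypertree θ}

end HypermapCollection

/-- The points (half-edges) of the ladder with `m` squares side by side. Its vertices are the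
pairs `(i, r)`, with `0 ≤ i ≤ m` the column and `r` the row (`true` for the top row).
* `vert i r` is the end at `(i, r)` of the vertical edge between `(i, true)` and `(i, false)`;
* `right i r` and `left i r` are the ends at `(i, r)` and at `(i + 1, r)`, respectively,
  of the horizontal edge between these two vertices. -/
inductive LadderPoint (m : ℕ) : Type
  | vert (i : Fin (m + 1)) (r : Bool)
  | right (i : Fin m) (r : Bool)
  | left (i : Fin m) (r : Bool)
  deriving DecidableEq, Fintype

namespace LadderPoint

variable {m : ℕ}

/-- Whether the point is in the top row. -/
def row : LadderPoint m → Bool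
  | vert _ r => r
  | right _ r => r
  | left _ r => r

/-- The other end of the edge. -/
def opposite : LadderPoint m → LadderPoint m
  | vert i r => vert i (!r)
  | right i r => left i r
  | left i r => right i r

/-- At each vertex, the next point in the cyclic order right, left, vertical, skipping those
that do not exist. This is the counterclockwise order at the vertices of the top row and the
clockwise order at those of the bottom row. -/
def next : LadderPoint m → LadderPoint m
  | right i r => if 0 < i.1 then left ⟨i.1 - 1, by omega⟩ r else vert ⟨i.1, by omega⟩ r
  | left i r => vert ⟨i.1 + 1, by omega⟩ r
  | vert i r =>
    if h : i.1 < m then right ⟨i.1, h⟩ r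
    else if h' : 0 < i.1 then left ⟨i.1 - 1, by omega⟩ r
    else vert i r

/-- At each vertex, the next point in the cyclic order right, vertical, left, skipping those
that do not exist. -/
def prev : LadderPoint m → LadderPoint m
  | right i r => vert ⟨i.1, by omega⟩ r
  | left i r => if h : i.1 + 1 < m then right ⟨i.1 + 1, h⟩ r else vert ⟨i.1 + 1, by omega⟩ r
  | vert i r =>
    if h' : 0 < i.1 then left ⟨i.1 - 1, by omega⟩ r
    else if h : i.1 < m then right ⟨i.1, h⟩ r
    else vert i r

theorem opposite_opposite (p : LadderPoint m) : p.opposite.opposite = p := by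
  cases p <;> simp [opposite]

theorem row_next (p : LadderPoint m) : p.next.row = p.row := by
  cases p <;> grind [next, row]

theorem row_prev (p : LadderPoint m) : p.prev.row = p.row := by
  cases p <;> grind [prev, row]

theorem prev_next (p : LadderPoint m) : p.next.prev = p := by
  rcases p with ⟨i, r⟩ | ⟨i, r⟩ | ⟨i, r⟩ <;> grind [next, prev]

theorem next_prev (p : LadderPoint m) : p.prev.next = p := by
  rcases p with ⟨i, r⟩ | ⟨i, r⟩ | ⟨i, r⟩ <;> grind [next, prev]

end LadderPoint

/-- The ladder map `(σ_m, α_m)` with `m` bounded faces, drawn in the plane: `σ_m` goes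
counterclockwise around each vertex, `α_m` exchanges the two ends of each edge. -/
def ladderMap (m : ℕ) : HypermapCollection (LadderPoint m) where
  σ :=
    { toFun := fun p => if p.row then p.next else p.prev
      invFun := fun p => if p.row then p.prev else p.next
      left_inv := fun p => by
        by_cases h : p.row <;>
          simp [h, LadderPoint.row_next, LadderPoint.row_prev, LadderPoint.prev_next,
            LadderPoint.next_prev]
      right_inv := fun p => by
        by_cases h : p.row <;>
          simp [h, LadderPoint.row_next, LadderPoint.row_prev, LadderPoint.prev_next,
            LadderPoint.next_prev] }
  α :=
    { toFun := LadderPoint.opposite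
      invFun := LadderPoint.opposite
      left_inv := LadderPoint.opposite_opposite
      right_inv := LadderPoint.opposite_opposite }

/-!
For a hypermap `(σ, α)` with `κ` components on `n` points, `z(σ) + z(α) = n + κ` holds exactly if
the genus is zero and every component has a single face: the spaces of functions that are constant
on the cycles of `σ`, respectively of `α`, then span all functions, and a function that is constant
on the faces differs from its translates by functions orthogonal to both spaces. A spanning
hypertree is thus a refinement with the right number of cycles that makes the ladder connected.

A refinement permutes the at most three half-edges at each vertex, and only the inverse of a full
rotation is excluded. Its components are detected by counting the two-colourings of the edges that
are constant on the cycles, which a transfer matrix does column by column. To the left of a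
column, a forest that can still be completed to a tree only remembers whether its two edges leaving
on the right belong to the same component. Counting the columns that lead from one of these two
states to the other gives a linear recursion with the matrix `!![4, 1; 8, 4]`, whose reversed
characteristic polynomial is `1 - 8 x + 8 x²`.
-/

section Cycles

variable {X Y : Type*}

theorem sameCycle_setoid_le_ker_iff {π : Perm X} {f : X → Y} :
    Perm.SameCycle.setoid π ≤ Setoid.ker f ↔ ∀ x, f (π x) = f x := by
  refine ⟨fun h x => (h ⟨1, rfl⟩ : f x = f (π x)).symm, ?_⟩
  rintro h x - ⟨k, rfl⟩
  change f x = f ((π ^ k) x)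
  induction k with
  | zero => rfl
  | succ k ih => rw [add_comm, zpow_one_add, Perm.mul_apply, h, ih]
  | pred k ih => rw [ih, ← h ((π ^ (-k - 1 : ℤ)) x), ← Perm.mul_apply, ← zpow_one_add,
      add_sub_cancel]

theorem sameCycle_permCongr {e : X ≃ Y} {π : Perm X} {x y : X} :
    (e.permCongr π).SameCycle (e x) (e y) ↔ π.SameCycle x y := by
  refine exists_congr fun k => ?_
  rw [← Equiv.permCongrHom_coe, ← map_zpow]
  simp

theorem numCycles_permCongr (e : X ≃ Y) (π : Perm X) : numCycles (e.permCongr π) = numCycles π :=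
  (Nat.card_congr (Quotient.congr e fun _ _ => sameCycle_permCongr.symm)).symm

theorem card_quotient_top [Nonempty X] : Nat.card (Quotient (⊤ : Setoid X)) = 1 :=
  Nat.card_eq_one_iff_unique.2
    ⟨Quotient.subsingleton_iff.2 rfl, ‹Nonempty X›.map (Quotient.mk _)⟩

theorem numCycles_eq_one_of_forall_sameCycle [Nonempty X] {π : Perm X}
    (h : ∀ x y, π.SameCycle x y) : numCycles π = 1 := by
  have htop : Perm.SameCycle.setoid π = ⊤ := top_unique fun x y _ => h x y
  rw [numCycles, htop, card_quotient_top]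

theorem orbitRel_closure_pair (σ α : Perm X) :
    MulAction.orbitRel (Subgroup.closure ({σ, α} : Set (Perm X))) X =
      Perm.SameCycle.setoid σ ⊔ Perm.SameCycle.setoid α := by
  set r := Perm.SameCycle.setoid σ ⊔ Perm.SameCycle.setoid α
  apply le_antisymm
  · rintro _ x ⟨⟨π, hπ⟩, rfl⟩
    suffices ∀ x, r (π x) x from this x
    induction hπ using Subgroup.closure_induction with
    | mem π hπ =>
      intro x
      obtain rfl | rfl := hπ
      · exact r.symm ((le_sup_left : _ ≤ r) ⟨1, rfl⟩)
      · exact r.symm ((le_sup_right : _ ≤ r) ⟨1, rfl⟩)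
    | one => exact r.refl
    | mul π ρ _ _ ihπ ihρ => exact fun x => r.trans (ihπ (ρ x)) (ihρ x)
    | inv π _ ih => exact fun x => r.symm (by simpa using ih (π⁻¹ x))
  · have hpow : ∀ π ∈ ({σ, α} : Set (Perm X)), ∀ (k : ℤ) (x : X),
        MulAction.orbitRel (Subgroup.closure {σ, α}) X x ((π ^ k) x) := fun π hπ k x =>
      ⟨⟨(π ^ k)⁻¹, inv_mem (zpow_mem (Subgroup.subset_closure hπ) k)⟩, (π ^ k).symm_apply_apply x⟩
    refine sup_le ?_ ?_
    · rintro x - ⟨k, rfl⟩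
      exact hpow σ (.inl rfl) k x
    · rintro x - ⟨k, rfl⟩
      exact hpow α (.inr rfl) k x

end Cycles

section Genus

variable {X K : Type*} [Field K]

variable (K) in
/-- The space of the functions `X → K` that are constant on the classes of `r`. -/
def constantOn (r : Setoid X) : Submodule K (X → K) :=
  LinearMap.range (LinearMap.funLeft K K (Quotient.mk r))

theorem mem_constantOn {r : Setoid X} {f : X → K} : f ∈ constantOn K r ↔ r ≤ Setoid.ker f := by
  constructor
  · rintro ⟨g, rfl⟩ x y h
    exact congrArg g (Quotient.sound h)
  · exact fun h => ⟨Quotient.lift f h, rfl⟩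

theorem mem_constantOn_sameCycle {π : Perm X} {f : X → K} :
    f ∈ constantOn K (Perm.SameCycle.setoid π) ↔ ∀ x, f (π x) = f x :=
  mem_constantOn.trans sameCycle_setoid_le_ker_iff

theorem finrank_constantOn [Finite X] (r : Setoid X) :
    Module.finrank K (constantOn K r) = Nat.card (Quotient r) := by
  have := Fintype.ofFinite (Quotient r)
  rw [constantOn, LinearMap.finrank_range_of_inj
    (LinearMap.funLeft_injective_of_surjective K K _ Quotient.mk_surjective),
    Module.finrank_fintype_fun_eq_card, Nat.card_eq_fintype_card]

theorem finrank_constantOn_sameCycle [Finite X] (π : Perm X) :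
    Module.finrank K (constantOn K (Perm.SameCycle.setoid π)) = numCycles π :=
  finrank_constantOn _

theorem constantOn_sup (r s : Setoid X) :
    constantOn K (r ⊔ s) = constantOn K r ⊓ constantOn K s := by
  ext f
  simp only [Submodule.mem_inf, mem_constantOn, sup_le_iff]

theorem dotProduct_comp_inv_sub_self [Fintype X] {π : Perm X} {f h : X → K}
    (hh : h ∈ constantOn K (Perm.SameCycle.setoid π)) : (f ∘ ⇑π⁻¹ - f) ⬝ᵥ h = 0 := by
  rw [mem_constantOn_sameCycle] at hh
  rw [sub_dotProduct, sub_eq_zero, dotProduct, dotProduct, ← Equiv.sum_comp π]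
  simp [hh]

/-- If `f` is invariant under `α⁻¹σ`, then `f ∘ α⁻¹ - f = f ∘ σ⁻¹ - f` is orthogonal to all
functions that are constant on the cycles of `σ` or on those of `α`. -/
theorem constantOn_inv_mul_eq_inf [Finite X] {σ α : Perm X}
    (h : constantOn K (Perm.SameCycle.setoid σ) ⊔ constantOn K (Perm.SameCycle.setoid α) = ⊤) :
    constantOn K (Perm.SameCycle.setoid (α⁻¹ * σ)) =
      constantOn K (Perm.SameCycle.setoid σ) ⊓ constantOn K (Perm.SameCycle.setoid α) := by
  have := Fintype.ofFinite X
  ext f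
  simp only [Submodule.mem_inf, mem_constantOn_sameCycle, Perm.mul_apply]
  constructor
  · intro hf
    have heq : f ∘ ⇑σ⁻¹ = f ∘ ⇑α⁻¹ := funext fun x => by simpa using (hf (σ⁻¹ x)).symm
    have hzero : f ∘ ⇑α⁻¹ - f = 0 := dotProduct_eq_zero _ fun w => by
      obtain ⟨u, hu, v, hv, rfl⟩ := Submodule.mem_sup.1 (h ▸ Submodule.mem_top : w ∈ _)
      rw [dotProduct_add, dotProduct_comp_inv_sub_self hv, ← heq, dotProduct_comp_inv_sub_self hu,
        add_zero]
    have hα : ∀ x, f (α⁻¹ x) = f x := congrFun (sub_eq_zero.1 hzero)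
    have hσ : ∀ x, f (σ⁻¹ x) = f x := congrFun (heq.trans (sub_eq_zero.1 hzero))
    exact ⟨fun x => by simpa using (hσ (σ x)).symm, fun x => by simpa using (hα (α x)).symm⟩
  · rintro ⟨hσ, hα⟩ x
    simpa [hσ] using (hα (α⁻¹ (σ x))).symm

end Genus

namespace HypermapCollection

variable {X : Type*} (H : HypermapCollection X)

theorem numComponents_eq_card_quotient_sup : H.numComponents =
    Nat.card (Quotient (Perm.SameCycle.setoid H.σ ⊔ Perm.SameCycle.setoid H.α)) := by
  rw [numComponents, MulAction.orbitRel.Quotient, orbitRel_closure_pair]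

theorem numFaces_eq_numComponents_and_genus_eq_zero_iff [Finite X] :
    H.numFaces = H.numComponents ∧ H.genus = 0 ↔
      numCycles H.σ + numCycles H.α = Nat.card X + H.numComponents := by
  constructor
  · rintro ⟨hF, hg⟩
    rw [genus, hF] at hg
    have : (numCycles H.σ + numCycles H.α : ℚ) = Nat.card X + H.numComponents := by linarith
    exact_mod_cast this
  · intro h
    have hdim := Submodule.finrank_sup_add_finrank_inf_eq
      (constantOn ℚ (Perm.SameCycle.setoid H.σ)) (constantOn ℚ (Perm.SameCycle.setoid H.α))
    have htop : constantOn ℚ (Perm.SameCycle.setoid H.σ) ⊔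
        constantOn ℚ (Perm.SameCycle.setoid H.α) = ⊤ := by
      have := Fintype.ofFinite X
      apply Submodule.eq_top_of_finrank_eq
      rw [← constantOn_sup, finrank_constantOn_sameCycle, finrank_constantOn_sameCycle,
        finrank_constantOn, ← numComponents_eq_card_quotient_sup] at hdim
      rw [Module.finrank_fintype_fun_eq_card, ← Nat.card_eq_fintype_card]
      lia
    have hF : H.numFaces = H.numComponents := by
      rw [numComponents_eq_card_quotient_sup, ← finrank_constantOn (K := ℚ), constantOn_sup,
        ← constantOn_inv_mul_eq_inf htop, finrank_constantOn_sameCycle, numFaces]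
    refine ⟨hF, ?_⟩
    rw [genus, hF]
    have : (numCycles H.σ + numCycles H.α : ℚ) = Nat.card X + H.numComponents := by
      exact_mod_cast h
    linarith

end HypermapCollection

section Colourings

variable {X A B : Type*}

theorem card_le_ker [Finite X] (r : Setoid X) :
    Nat.card {f : X → Bool // r ≤ Setoid.ker f} = 2 ^ Nat.card (Quotient r) := by
  rw [Nat.card_congr (Setoid.liftEquiv r), Nat.card_fun, Nat.card_eq_two_iff.2
    ⟨true, false, by decide, by grind⟩]

theorem two_pow_numCycles [Finite X] (π : Perm X) :
    2 ^ numCycles π = Nat.card {f : X → Bool // ∀ x, f (π x) = f x} := by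
  rw [numCycles, ← card_le_ker]
  simp only [sameCycle_setoid_le_ker_iff]

theorem HypermapCollection.two_pow_numComponents [Finite X] (H : HypermapCollection X) :
    2 ^ H.numComponents =
      Nat.card {f : X → Bool // (∀ x, f (H.σ x) = f x) ∧ ∀ x, f (H.α x) = f x} := by
  rw [numComponents_eq_card_quotient_sup, ← card_le_ker]
  simp only [sup_le_iff, sameCycle_setoid_le_ker_iff]

theorem numCycles_prodCongrRight [Fintype A] [Finite B] (s : A → Perm B) :
    numCycles (Equiv.prodCongrRight s) = ∑ a, numCycles (s a) := by
  refine Nat.pow_right_injective le_rfl ?_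
  simp only [← Finset.prod_pow_eq_pow_sum, two_pow_numCycles]
  rw [← Nat.card_pi, ← Nat.card_congr Equiv.subtypePiEquivPi]
  refine Nat.card_congr ((Equiv.curry A B Bool).subtypeEquiv fun f => ?_)
  simp [Prod.forall, Function.curry]

theorem numCycles_subtypePerm_add_card [Finite X] {p : X → Prop} {π : Perm X}
    (h : ∀ x, p (π x) ↔ p x) (hfix : ∀ x, ¬ p x → π x = x) :
    numCycles (π.subtypePerm h) + Nat.card {x // ¬ p x} = numCycles π := by
  classical
  refine Nat.pow_right_injective le_rfl ?_
  simp only [pow_add, two_pow_numCycles]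
  rw [← Nat.card_eq_two_iff.2 ⟨true, false, by decide, by grind⟩, ← Nat.card_fun, ← Nat.card_prod,
    ← Nat.card_congr Equiv.prodSubtypeFstEquivSubtypeProd]
  refine (Nat.card_congr ((Equiv.piEquivPiSubtypeProd p fun _ => Bool).subtypeEquiv
    fun f => ⟨fun hf (y : {x // p x}) => hf y, fun hf x => ?_⟩)).symm
  by_cases hx : p x
  · exact hf ⟨x, hx⟩
  · rw [hfix x hx]

theorem exists_prodCongrRight_eq {π : Perm (A × B)} (h : ∀ x, (π x).1 = x.1) :
    ∃ s : A → Perm B, Equiv.prodCongrRight s = π := by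
  have h' : ∀ x, (π.symm x).1 = x.1 := fun x => by simpa using (h (π.symm x)).symm
  refine ⟨fun a => ⟨fun b => (π (a, b)).2, fun b => (π.symm (a, b)).2, fun b => ?_, fun b => ?_⟩,
    Perm.ext fun x => ?_⟩
  · exact (congrArg (fun a' => (π.symm (a', (π (a, b)).2)).2) (h (a, b)).symm).trans (by simp)
  · exact (congrArg (fun a' => (π (a', (π.symm (a, b)).2)).2) (h' (a, b)).symm).trans (by simp)
  · exact Prod.ext (h x).symm rfl

end Colourings

section SmallCycles

variable {X : Type*}

instance {n : ℕ} (π : Perm (Fin n)) : DecidableRel (Perm.SameCycle.setoid π) :=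
  inferInstanceAs (DecidableRel π.SameCycle)

/-- The number of cycles of a permutation of `Fin n`, in a form that can be evaluated. -/
def countCycles {n : ℕ} (π : Perm (Fin n)) : ℕ :=
  Fintype.card (Quotient (Perm.SameCycle.setoid π))

theorem numCycles_eq_countCycles {n : ℕ} (π : Perm (Fin n)) : numCycles π = countCycles π :=
  Nat.card_eq_fintype_card

theorem countCycles_add_countCycles_iff {n : ℕ} (h0 : 0 < n) (hn : n ≤ 3) {γ θ : Perm (Fin n)}
    (h : ∀ x y, γ.SameCycle x y) :
    countCycles θ + countCycles (γ⁻¹ * θ) = n + 1 ↔ ¬ (n = 3 ∧ θ = γ⁻¹) := by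
  interval_cases n <;> revert γ θ <;> decide +kernel

theorem numCycles_add_numCycles_iff [Finite X] [Nonempty X] (hX : Nat.card X ≤ 3) {γ θ : Perm X}
    (h : ∀ x y, γ.SameCycle x y) :
    numCycles θ + numCycles (γ⁻¹ * θ) = Nat.card X + 1 ↔ ¬ (Nat.card X = 3 ∧ θ = γ⁻¹) := by
  let e := Finite.equivFin X
  have h' : ∀ x y, (e.permCongrHom γ).SameCycle x y := fun x y => by
    simpa using sameCycle_permCongr (e := e).2 (h (e.symm x) (e.symm y))
  have key := countCycles_add_countCycles_iff Nat.card_pos hX (θ := e.permCongrHom θ) h'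
  rwa [← map_inv, ← map_mul, EmbeddingLike.apply_eq_iff_eq, ← numCycles_eq_countCycles,
    ← numCycles_eq_countCycles, Equiv.permCongrHom_coe, numCycles_permCongr,
    numCycles_permCongr] at key

theorem HypermapCollection.isHypermap_of_forall_sameCycle_α [Nonempty X] {H : HypermapCollection X}
    (h : ∀ x y, H.α.SameCycle x y) : H.IsHypermap := by
  have htop : Perm.SameCycle.setoid H.σ ⊔ Perm.SameCycle.setoid H.α = ⊤ :=
    top_unique (le_sup_of_le_right fun x y _ => h x y)
  rw [IsHypermap, numComponents_eq_card_quotient_sup, htop, card_quotient_top]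

theorem genus_eq_zero_iff_of_forall_sameCycle [Finite X] [Nonempty X] (hX : Nat.card X ≤ 3)
    {γ θ : Perm X} (h : ∀ x y, γ.SameCycle x y) :
    (HypermapCollection.mk θ γ).genus = 0 ↔ ¬ (Nat.card X = 3 ∧ θ = γ⁻¹) := by
  rw [← numCycles_add_numCycles_iff hX h, HypermapCollection.genus,
    HypermapCollection.isHypermap_of_forall_sameCycle_α h, numCycles_eq_one_of_forall_sameCycle h,
    HypermapCollection.numFaces, ← @Nat.cast_inj ℚ]
  push_cast
  constructor <;> intro hg <;> linarith

theorem isRefinement_iff [Finite X] {γ θ : Perm X}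
    (hγ : ∀ x, Nat.card {y // γ.SameCycle x y} ≤ 3) :
    IsRefinement θ γ ↔ ∀ x, γ.SameCycle x (θ x) ∧
      ¬ (Nat.card {y // γ.SameCycle x y} = 3 ∧ ∀ y, γ.SameCycle x y → θ y = γ⁻¹ y) := by
  have genus_iff : ∀ x (h : ∀ y, γ.SameCycle x (θ y) ↔ γ.SameCycle x y),
      (HypermapCollection.mk (θ.subtypePerm h)
        (γ.subtypePerm fun _ => Perm.sameCycle_apply_right)).genus = 0 ↔
      ¬ (Nat.card {y // γ.SameCycle x y} = 3 ∧ ∀ y, γ.SameCycle x y → θ y = γ⁻¹ y) := by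
    intro x h
    have : Nonempty {y // γ.SameCycle x y} := ⟨⟨x, .refl _ _⟩⟩
    rw [genus_eq_zero_iff_of_forall_sameCycle (hγ x) fun y z =>
      Perm.sameCycle_subtypePerm.2 (y.2.symm.trans z.2), Perm.ext_iff, Subtype.forall]
    simp only [Subtype.ext_iff]
    rfl
  constructor
  · intro hr x
    obtain ⟨h, hg⟩ := hr x
    exact ⟨(h x).2 (.refl _ _), (genus_iff x h).1 hg⟩
  · intro hr x
    have h : ∀ y, γ.SameCycle x (θ y) ↔ γ.SameCycle x y := fun y =>
      ⟨fun hy => hy.trans (hr y).1.symm, fun hy => hy.trans (hr y).1⟩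
    exact ⟨h, (genus_iff x h).2 (hr x).2⟩

end SmallCycles

section Transfer

open scoped Matrix

theorem vecMul_mono {ι κ : Type*} [Fintype ι] {u v : ι → ℕ} (h : u ≤ v) (M : Matrix ι κ ℕ) :
    u ᵥ* M ≤ v ᵥ* M := fun _ =>
  dotProduct_le_dotProduct_of_nonneg_right h fun _ => Nat.zero_le _

theorem card_exists_and {ι A B : Type*} [Fintype ι] [Finite A] [Finite B] {P : ι → A → Prop}
    {Q : ι → B → Prop} (hP : ∀ a i j, P i a → P j a → i = j) :
    Nat.card {y : A × B // ∃ i, P i y.1 ∧ Q i y.2} =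
      ∑ i, Nat.card {a // P i a} * Nat.card {b // Q i b} := by
  simp only [← Nat.card_prod]
  rw [← Nat.card_sigma]
  refine (Nat.card_congr (Equiv.ofBijective
    (fun z => ⟨(z.2.1.1, z.2.2.1), z.1, z.2.1.2, z.2.2.2⟩) ⟨?_, ?_⟩)).symm
  · rintro ⟨i, ⟨a, ha⟩, b, hb⟩ ⟨j, ⟨a', ha'⟩, b', hb'⟩ h
    obtain ⟨rfl, rfl⟩ := Prod.ext_iff.1 (congrArg Subtype.val h)
    obtain rfl := hP _ _ _ ha ha'
    rfl
  · rintro ⟨⟨a, b⟩, i, ha, hb⟩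
    exact ⟨⟨i, ⟨a, ha⟩, b, hb⟩, rfl⟩

theorem card_snoc {ι A : Type*} [Fintype ι] [Finite A] {k : ℕ} {P : ι → (Fin k → A) → Prop}
    {Q : ι → A → Prop} {R : (Fin (k + 1) → A) → Prop} (hP : ∀ s i j, P i s → P j s → i = j)
    (hR : ∀ s a, R (Fin.snoc s a : Fin (k + 1) → A) ↔ ∃ i, P i s ∧ Q i a) :
    Nat.card {t // R t} = ∑ i, Nat.card {s // P i s} * Nat.card {a // Q i a} := by
  rw [← card_exists_and hP]
  exact (Nat.card_congr (((Equiv.prodComm _ _).trans (Fin.snocEquiv fun _ => A)).subtypeEquiv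
    fun y => (hR y.1 y.2).symm)).symm

end Transfer

namespace LadderPoint

variable {m : ℕ}

/-- The vertex of a half-edge, as a pair of a column and a row. -/
def vertex : LadderPoint m → Fin (m + 1) × Bool
  | vert i r => (i, r)
  | right i r => (i.castSucc, r)
  | left i r => (i.succ, r)

/-- The direction of a half-edge at its vertex: `0` for left, `1` for vertical, `2` for right. -/
def dir : LadderPoint m → Fin 3
  | vert _ _ => 1
  | right _ _ => 2
  | left _ _ => 0

/-- There is a half-edge in direction `d` at the vertex `v`. -/
def HasDirection (v : Fin (m + 1) × Bool) (d : Fin 3) : Prop :=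
  (d = 0 → v.1 ≠ 0) ∧ (d = 2 → v.1 ≠ Fin.last m)

theorem hasDirection_vertex_dir (p : LadderPoint m) : HasDirection p.vertex p.dir := by
  cases p <;> simp [HasDirection, vertex, dir, Fin.succ_ne_zero, Fin.castSucc_ne_last]

theorem ext_coord {p q : LadderPoint m} (hv : p.vertex = q.vertex) (hd : p.dir = q.dir) :
    p = q := by
  cases p <;> cases q <;> simp_all [vertex, dir]

theorem HasDirection.exists_eq {v : Fin (m + 1) × Bool} {d : Fin 3} (h : HasDirection v d) :
    ∃ p : LadderPoint m, p.vertex = v ∧ p.dir = d := by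
  obtain ⟨i, r⟩ := v
  fin_cases d
  · obtain ⟨j, rfl⟩ := Fin.exists_succ_eq.2 (h.1 rfl)
    exact ⟨left j r, rfl, rfl⟩
  · exact ⟨vert i r, rfl, rfl⟩
  · obtain ⟨j, rfl⟩ := Fin.exists_castSucc_eq.2 (h.2 rfl)
    exact ⟨right j r, rfl, rfl⟩

/-- The coordinates of a half-edge are its vertex and its direction there. -/
noncomputable def coordEquiv :
    LadderPoint m ≃ {y : (Fin (m + 1) × Bool) × Fin 3 // HasDirection y.1 y.2} :=
  Equiv.ofBijective (fun p => ⟨(p.vertex, p.dir), p.hasDirection_vertex_dir⟩)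
    ⟨fun _ _ h => ext_coord (congrArg (·.1.1) h) (congrArg (·.1.2) h), fun ⟨_, hy⟩ =>
      let ⟨p, hv, hd⟩ := hy.exists_eq
      ⟨p, Subtype.ext (Prod.ext hv hd)⟩⟩

/-- The half-edges at a vertex correspond to the directions there. -/
noncomputable def vertexEquiv (v : Fin (m + 1) × Bool) :
    {q : LadderPoint m // v = q.vertex} ≃ {d // HasDirection v d} :=
  Equiv.ofBijective (fun ⟨q, hq⟩ => ⟨q.dir, hq ▸ q.hasDirection_vertex_dir⟩)
    ⟨fun p q h => Subtype.ext (ext_coord (p.2.symm.trans q.2) (congrArg (·.1) h)), fun ⟨_, hd⟩ =>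
      let ⟨p, hv, hp⟩ := hd.exists_eq
      ⟨⟨p, hv.symm⟩, Subtype.ext hp⟩⟩

/-- The points, listed by kind. -/
def equivSum : LadderPoint m ≃ (Fin (m + 1) × Bool) ⊕ (Fin m × Bool) ⊕ (Fin m × Bool) where
  toFun
    | vert i r => .inl (i, r)
    | right i r => .inr (.inl (i, r))
    | left i r => .inr (.inr (i, r))
  invFun
    | .inl (i, r) => vert i r
    | .inr (.inl (i, r)) => right i r
    | .inr (.inr (i, r)) => left i r
  left_inv p := by cases p <;> rfl
  right_inv q := by rcases q with _ | _ | _ <;> rfl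

theorem card_eq : Nat.card (LadderPoint m) = 6 * m + 2 := by
  rw [Nat.card_congr equivSum]
  simp only [Nat.card_sum, Nat.card_prod, Nat.card_fin, Nat.card_eq_fintype_card (α := Bool),
    Fintype.card_bool]
  ring

theorem card_not_hasDirection :
    Nat.card {y : (Fin (m + 1) × Bool) × Fin 3 // ¬ HasDirection y.1 y.2} = 4 := by
  classical
  have h := Nat.card_congr
    (Equiv.sumCompl fun y : (Fin (m + 1) × Bool) × Fin 3 => HasDirection y.1 y.2)
  rw [Nat.card_sum, ← Nat.card_congr coordEquiv, card_eq] at h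
  simp only [Nat.card_prod, Nat.card_fin, Nat.card_eq_fintype_card (α := Bool),
    Fintype.card_bool] at h
  lia

/-- The edge of a half-edge. -/
def edge : LadderPoint m → Fin (m + 1) ⊕ (Fin m × Bool)
  | vert i _ => .inl i
  | right i r => .inr (i, r)
  | left i r => .inr (i, r)

theorem edge_surjective : Function.Surjective (edge : LadderPoint m → _)
  | .inl i => ⟨vert i true, rfl⟩
  | .inr (i, r) => ⟨right i r, rfl⟩

section LadderMap

theorem sameCycle_setoid_ladderMap_α :
    Perm.SameCycle.setoid (ladderMap m).α = Setoid.ker edge := by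
  refine le_antisymm (sameCycle_setoid_le_ker_iff.2 fun p => by cases p <;> rfl) fun p q h => ?_
  obtain rfl | hpq := eq_or_ne p q
  · exact .refl _ _
  · refine ⟨1, ?_⟩
    change p.opposite = q
    cases p <;> cases q <;> simp_all [Setoid.ker_def, edge, opposite, ← Bool.eq_not]

theorem numCycles_ladderMap_α (m : ℕ) : numCycles (ladderMap m).α = 3 * m + 1 := by
  rw [numCycles, sameCycle_setoid_ladderMap_α,
    Nat.card_congr (Setoid.quotientKerEquivOfSurjective _ edge_surjective)]
  simp only [Nat.card_sum, Nat.card_prod, Nat.card_fin, Nat.card_eq_fintype_card (α := Bool),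
    Fintype.card_bool]
  ring

theorem vertex_ladderMap_σ (p : LadderPoint m) : ((ladderMap m).σ p).vertex = p.vertex := by
  change (if p.row then p.next else p.prev).vertex = p.vertex
  rcases p with ⟨i, r⟩ | ⟨i, r⟩ | ⟨i, r⟩ <;> cases r <;>
    simp only [row, next, prev] <;> split_ifs <;>
    simp [vertex, Prod.ext_iff, Fin.ext_iff] <;> lia

theorem sameCycle_setoid_ladderMap_σ :
    Perm.SameCycle.setoid (ladderMap m).σ = Setoid.ker vertex := by
  refine le_antisymm (sameCycle_setoid_le_ker_iff.2 vertex_ladderMap_σ) fun p q h => ?_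
  have sameCycle_vert : ∀ p : LadderPoint m,
      (ladderMap m).σ.SameCycle p (vert p.vertex.1 p.vertex.2) := by
    rintro (⟨i, r⟩ | ⟨i, _ | _⟩ | ⟨i, _ | _⟩)
    · exact .refl _ _
    · exact ⟨1, rfl⟩
    · exact .symm ⟨1, by simp [ladderMap, next, row, vertex]⟩
    · exact .symm ⟨1, by simp [ladderMap, prev, row, vertex]⟩
    · exact ⟨1, rfl⟩
  exact (sameCycle_vert p).trans (Setoid.ker_def.1 h ▸ (sameCycle_vert q).symm)

theorem sameCycle_ladderMap_σ (p q : LadderPoint m) :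
    (ladderMap m).σ.SameCycle p q ↔ p.vertex = q.vertex :=
  Setoid.ext_iff.1 sameCycle_setoid_ladderMap_σ p q

/-- The counterclockwise rotation of the directions, at a vertex with all three of them. -/
def vertexRotation (r : Bool) : Perm (Fin 3) := if r then finRotate 3 else (finRotate 3)⁻¹

theorem dir_ladderMap_σ {p : LadderPoint m} (h : ∀ d, HasDirection p.vertex d) :
    ((ladderMap m).σ p).dir = vertexRotation p.vertex.2 p.dir := by
  change (if p.row then p.next else p.prev).dir = _
  have h0 : 0 < p.vertex.1.1 := Nat.pos_of_ne_zero fun h0 => (h 0).1 rfl (Fin.ext h0)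
  have hm : p.vertex.1.1 < m :=
    lt_of_le_of_ne (Nat.le_of_lt_succ p.vertex.1.2) fun hm => (h 2).2 rfl (Fin.ext hm)
  rcases p with ⟨i, r⟩ | ⟨i, r⟩ | ⟨i, r⟩ <;> cases r <;>
    simp_all [next, prev, vertex, row, dir, vertexRotation]
  all_goals rfl

theorem card_sameCycle_ladderMap_σ_le (p : LadderPoint m) :
    Nat.card {q // (ladderMap m).σ.SameCycle p q} ≤ 3 := by
  simp only [sameCycle_ladderMap_σ]
  rw [Nat.card_congr (vertexEquiv p.vertex)]
  exact (Finite.card_subtype_le _).trans_eq (Nat.card_fin 3)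

theorem card_sameCycle_ladderMap_σ_eq_three_iff (p : LadderPoint m) :
    Nat.card {q // (ladderMap m).σ.SameCycle p q} = 3 ↔ ∀ d, HasDirection p.vertex d := by
  classical
  simp only [sameCycle_ladderMap_σ]
  rw [Nat.card_congr (vertexEquiv p.vertex), Nat.card_eq_fintype_card, Fintype.card_subtype]
  simpa using Finset.card_filter_eq_iff (s := (Finset.univ : Finset (Fin 3)))
    (p := HasDirection p.vertex)

end LadderMap

section Columns

/-- A permutation of the three directions left, vertical, right, for each of the two vertices of
a column. -/
abbrev Column := Bool → Perm (Fin 3)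

/-- The columns that occur in the refinements of the vertices: at a vertex with three half-edges,
only the inverse of the rotation is excluded. -/
def IsRefining (c : Column) : Prop := ∀ r, c r ≠ (vertexRotation r)⁻¹

/-- The directions missing at the two ends of the ladder are fixed. -/
def FixesEnds (s : Fin (m + 1) → Column) : Prop :=
  ∀ r, s 0 r 0 = 0 ∧ s (Fin.last m) r 2 = 2

/-- The action of the columns of `s` on all pairs of a vertex and a direction. -/
def columnsPerm (s : Fin (m + 1) → Column) : Perm ((Fin (m + 1) × Bool) × Fin 3) :=
  Equiv.prodCongrRight fun v => s v.1 v.2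

theorem fixesEnds_iff {s : Fin (m + 1) → Column} :
    FixesEnds s ↔ ∀ y, ¬ HasDirection y.1 y.2 → columnsPerm s y = y := by
  constructor
  · rintro hs ⟨⟨i, r⟩, d⟩ h
    simp only [HasDirection, not_and_or, Classical.not_imp, not_not] at h
    obtain ⟨rfl, rfl⟩ | ⟨rfl, rfl⟩ := h
    · simp [columnsPerm, (hs r).1]
    · simp [columnsPerm, (hs r).2]
  · intro h r
    exact ⟨congrArg (·.2) (h ((0, r), 0) (by simp [HasDirection])),
      congrArg (·.2) (h ((Fin.last m, r), 2) (by simp [HasDirection]))⟩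

theorem FixesEnds.hasDirection_iff {s : Fin (m + 1) → Column} (hs : FixesEnds s)
    (y : (Fin (m + 1) × Bool) × Fin 3) :
    HasDirection (columnsPerm s y).1 (columnsPerm s y).2 ↔ HasDirection y.1 y.2 := by
  rw [fixesEnds_iff] at hs
  refine not_iff_not.1 ⟨fun hy => ?_, fun hy => by rwa [hs y hy]⟩
  rwa [(columnsPerm s).injective (hs _ hy)] at hy

/-- The permutation of the half-edges of the ladder that preserves the vertices and acts on the
directions there by `s`. -/
noncomputable def assemble (s : Fin (m + 1) → Column) (hs : FixesEnds s) : Perm (LadderPoint m) :=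
  coordEquiv.symm.permCongr ((columnsPerm s).subtypePerm hs.hasDirection_iff)

theorem coord_assemble {s : Fin (m + 1) → Column} (hs : FixesEnds s) (p : LadderPoint m) :
    ((assemble s hs p).vertex, (assemble s hs p).dir) = columnsPerm s (p.vertex, p.dir) := by
  have : coordEquiv (assemble s hs p) =
      (columnsPerm s).subtypePerm hs.hasDirection_iff (coordEquiv p) := by simp [assemble]
  exact congrArg Subtype.val this

theorem vertex_assemble {s : Fin (m + 1) → Column} (hs : FixesEnds s) (p : LadderPoint m) :
    (assemble s hs p).vertex = p.vertex := congrArg (·.1) (coord_assemble hs p)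

theorem dir_assemble {s : Fin (m + 1) → Column} (hs : FixesEnds s) (p : LadderPoint m) :
    (assemble s hs p).dir = s p.vertex.1 p.vertex.2 p.dir := congrArg (·.2) (coord_assemble hs p)

theorem assemble_injective {s t : Fin (m + 1) → Column} (hs : FixesEnds s) (ht : FixesEnds t)
    (h : assemble s hs = assemble t ht) : s = t := by
  funext i r
  ext1 d
  by_cases hd : HasDirection (i, r) d
  · obtain ⟨p, hv, rfl⟩ := hd.exists_eq
    have := (dir_assemble hs p).symm.trans (h ▸ dir_assemble ht p)
    rwa [hv] at this
  · exact congrArg (·.2) ((fixesEnds_iff.1 hs ((i, r), d) hd).trans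
      (fixesEnds_iff.1 ht ((i, r), d) hd).symm)

theorem exists_assemble_eq {θ : Perm (LadderPoint m)} (h : ∀ p, (θ p).vertex = p.vertex) :
    ∃ s, ∃ hs : FixesEnds s, assemble s hs = θ := by
  classical
  have extend_coord : ∀ p, θ.extendDomain coordEquiv (p.vertex, p.dir) =
      ((θ p).vertex, (θ p).dir) := Perm.extendDomain_apply_image θ coordEquiv
  have extend_of_not : ∀ y, ¬ HasDirection y.1 y.2 → θ.extendDomain coordEquiv y = y :=
    fun y => Perm.extendDomain_apply_not_subtype θ coordEquiv
  have extend_fst : ∀ y, (θ.extendDomain coordEquiv y).1 = y.1 := by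
    intro y
    by_cases hy : HasDirection y.1 y.2
    · obtain ⟨p, hv, hd⟩ := hy.exists_eq
      rw [← Prod.mk.eta (p := y), ← hv, ← hd, extend_coord, h]
    · rw [extend_of_not y hy]
  obtain ⟨t, ht⟩ := exists_prodCongrRight_eq extend_fst
  have hcols : columnsPerm (fun i r => t (i, r)) = θ.extendDomain coordEquiv := ht
  have hs : FixesEnds fun i r => t (i, r) := fixesEnds_iff.2 fun y hy => by
    rw [hcols, extend_of_not y hy]
  refine ⟨_, hs, Perm.ext fun p => ?_⟩
  have hp := (coord_assemble hs p).trans ((DFunLike.congr_fun hcols _).trans (extend_coord p))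
  exact ext_coord (congrArg (·.1) hp) (congrArg (·.2) hp)

theorem isRefinement_assemble_iff {s : Fin (m + 1) → Column} (hs : FixesEnds s) :
    IsRefinement (assemble s hs) (ladderMap m).σ ↔ ∀ i, IsRefining (s i) := by
  have eq_inv_iff : ∀ p : LadderPoint m,
      ((∀ d, HasDirection p.vertex d) ∧
        ∀ q, p.vertex = q.vertex → assemble s hs q = (ladderMap m).σ⁻¹ q) ↔
      s p.vertex.1 p.vertex.2 = (vertexRotation p.vertex.2)⁻¹ := by
    intro p
    constructor
    · rintro ⟨hp, hθ⟩
      refine eq_inv_of_mul_eq_one_right (Perm.ext fun d => ?_)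
      obtain ⟨q, hv, rfl⟩ := (hp d).exists_eq
      have hq := Perm.eq_inv_iff_eq.1 (hθ q hv.symm)
      have hdir := dir_ladderMap_σ (p := assemble s hs q) (by rwa [vertex_assemble, hv])
      rw [hq, dir_assemble, vertex_assemble, hv] at hdir
      exact hdir.symm
    · intro hrot
      have hne : ∀ r, (vertexRotation r)⁻¹ 0 ≠ 0 ∧ (vertexRotation r)⁻¹ 2 ≠ 2 := by decide
      have hp : ∀ d, HasDirection p.vertex d := fun d =>
        ⟨fun _ h0 => (hne p.vertex.2).1 (by rw [← hrot, h0, (hs _).1]),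
          fun _ hm => (hne p.vertex.2).2 (by rw [← hrot, hm, (hs _).2])⟩
      refine ⟨hp, fun q hq => Perm.eq_inv_iff_eq.2 (ext_coord ?_ ?_)⟩
      · rw [vertex_ladderMap_σ, vertex_assemble]
      · rw [dir_ladderMap_σ (by rwa [vertex_assemble, ← hq]), dir_assemble, vertex_assemble, ← hq,
          hrot, ← Perm.mul_apply, mul_inv_cancel, Perm.one_apply]
  rw [isRefinement_iff card_sameCycle_ladderMap_σ_le]
  simp only [card_sameCycle_ladderMap_σ_eq_three_iff]
  simp only [sameCycle_ladderMap_σ, eq_inv_iff, vertex_assemble, true_and]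
  exact ⟨fun h i r => h (vert i r), fun h p => h _ _⟩

theorem exists_assemble_eq_of_isRefinement {θ : Perm (LadderPoint m)}
    (h : IsRefinement θ (ladderMap m).σ) : ∃ s, ∃ hs : FixesEnds s, assemble s hs = θ := by
  rw [isRefinement_iff card_sameCycle_ladderMap_σ_le] at h
  exact exists_assemble_eq fun p => ((sameCycle_ladderMap_σ _ _).1 (h p).1).symm

/-- The number of cycles in a column. -/
def columnCycles (c : Column) : ℕ := countCycles (c true) + countCycles (c false)

theorem numCycles_assemble_add_four {s : Fin (m + 1) → Column} (hs : FixesEnds s) :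
    numCycles (assemble s hs) + 4 = ∑ i, columnCycles (s i) := by
  rw [assemble, numCycles_permCongr, ← card_not_hasDirection (m := m),
    numCycles_subtypePerm_add_card _ (fixesEnds_iff.1 hs), columnsPerm, numCycles_prodCongrRight,
    Fintype.sum_prod_type]
  simp only [Fintype.sum_bool, numCycles_eq_countCycles, columnCycles]

end Columns

section Strips

open scoped Matrix

/-- The colours `a`, `v`, `b` of the directions left, vertical, right are constant on the cycles
of `π`. -/
def Respects (π : Perm (Fin 3)) (a v b : Bool) : Prop := ∀ d, ![a, v, b] (π d) = ![a, v, b] d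

instance (π : Perm (Fin 3)) (a v b : Bool) : Decidable (Respects π a v b) :=
  inferInstanceAs (Decidable (∀ _, _))

/-- Colourings of the edges of a strip of `k` columns that are constant on the cycles of `s`.
The horizontal edges are coloured by `e`, where those of index `0` and `k` leave the strip on the
left and on the right; the vertical ones by `v`. -/
def IsColouring {k : ℕ} (s : Fin k → Column) (e : Fin (k + 1) → Bool → Bool) (v : Fin k → Bool) :
    Prop :=
  ∀ i r, Respects (s i r) (e i.castSucc r) (v i) (e i.succ r)

/-- The number of colourings of a strip by the colours of its edges leaving on the right, when
those leaving on the left have colour `true`. -/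
noncomputable def numColourings {k : ℕ} (s : Fin k → Column) (q : Bool → Bool) : ℕ :=
  Nat.card {x : (Fin (k + 1) → Bool → Bool) × (Fin k → Bool) //
    IsColouring s x.1 x.2 ∧ x.1 0 = (fun _ => true) ∧ x.1 (Fin.last k) = q}

/-- The number of ways to colour the vertical edge of a column between horizontal edges coloured
by `p` on the left and by `q` on the right. -/
def transferMatrix (c : Column) : Matrix (Bool → Bool) (Bool → Bool) ℕ :=
  fun p q => Fintype.card {v : Bool // ∀ r, Respects (c r) (p r) v (q r)}

theorem isColouring_snoc_iff {k : ℕ} {s : Fin k → Column} {c : Column}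
    {e : Fin (k + 2) → Bool → Bool} {v : Fin (k + 1) → Bool} :
    IsColouring (Fin.snoc s c : Fin (k + 1) → Column) e v ↔
      IsColouring s (Fin.init e) (Fin.init v) ∧ ∀ r,
        Respects (c r) (e (Fin.last k).castSucc r) (v (Fin.last k)) (e (Fin.last (k + 1)) r) := by
  simp only [IsColouring, Fin.forall_fin_succ', Fin.snoc_castSucc, Fin.snoc_last, Fin.init,
    Fin.succ_castSucc, Fin.succ_last]

theorem numColourings_snoc {k : ℕ} (s : Fin k → Column) (c : Column) :
    numColourings (Fin.snoc s c : Fin (k + 1) → Column) =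
      numColourings s ᵥ* transferMatrix c := by
  funext q
  simp only [Matrix.vecMul, dotProduct, numColourings, transferMatrix, ← Nat.card_eq_fintype_card]
  rw [← card_exists_and fun x p p' h h' => h.2.2.symm.trans h'.2.2]
  refine Nat.card_congr (Equiv.ofBijective (fun ⟨(e, v), h, h0, hq⟩ =>
    ⟨((Fin.init e, Fin.init v), v (Fin.last k)), e (Fin.last k).castSucc,
      ⟨(isColouring_snoc_iff.1 h).1, h0, rfl⟩, hq ▸ (isColouring_snoc_iff.1 h).2⟩) ⟨?_, ?_⟩)
  · rintro ⟨⟨e, v⟩, h, h0, hq⟩ ⟨⟨e', v'⟩, h', h0', hq'⟩ hx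
    simp only [Subtype.mk.injEq, Prod.mk.injEq] at hx hq hq' ⊢
    rw [← Fin.snoc_init_self e, ← Fin.snoc_init_self e', ← Fin.snoc_init_self v,
      ← Fin.snoc_init_self v', hx.1.1, hx.1.2, hx.2, hq, hq']
    exact ⟨rfl, rfl⟩
  · rintro ⟨⟨⟨e, v⟩, w⟩, p, ⟨h, h0, hp⟩, hw⟩
    refine ⟨⟨(Fin.snoc e q, Fin.snoc v w), isColouring_snoc_iff.2 ?_, ?_,
      Fin.snoc_last (α := fun _ => Bool → Bool) _ _⟩, ?_⟩
    · simp only [Fin.init_snoc, Fin.snoc_last, Fin.snoc_castSucc]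
      exact ⟨h, by rwa [← hp] at hw⟩
    · exact (Fin.snoc_castSucc (α := fun _ => Bool → Bool) q e 0).trans h0
    · simp only [Fin.init_snoc, Fin.snoc_last]

end Strips

section Components

/-- The colouring of the half-edges of the ladder induced by a colouring of its edges. -/
def colour (e : Fin (m + 2) → Bool → Bool) (v : Fin (m + 1) → Bool) : LadderPoint m → Bool
  | vert i _ => v i
  | right i r => e i.castSucc.succ r
  | left i r => e i.castSucc.succ r

theorem colour_eq (e : Fin (m + 2) → Bool → Bool) (v : Fin (m + 1) → Bool) (p : LadderPoint m) :
    colour e v p =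
      ![e p.vertex.1.castSucc p.vertex.2, v p.vertex.1, e p.vertex.1.succ p.vertex.2] p.dir := by
  cases p <;> rfl

theorem colour_ladderMap_α (e : Fin (m + 2) → Bool → Bool) (v : Fin (m + 1) → Bool)
    (p : LadderPoint m) : colour e v ((ladderMap m).α p) = colour e v p := by
  cases p <;> rfl

theorem colour_assemble_iff {s : Fin (m + 1) → Column} (hs : FixesEnds s)
    {e : Fin (m + 2) → Bool → Bool} {v : Fin (m + 1) → Bool} :
    (∀ p, colour e v (assemble s hs p) = colour e v p) ↔ IsColouring s e v := by
  simp only [colour_eq, vertex_assemble, dir_assemble]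
  refine ⟨fun h i r d => ?_, fun h p => h _ _ _⟩
  by_cases hd : HasDirection (i, r) d
  · obtain ⟨p, hv, rfl⟩ := hd.exists_eq
    have := h p
    rwa [hv] at this
  · have : s i r d = d := congrArg (·.2) (fixesEnds_iff.1 hs ((i, r), d) hd)
    rw [this]

theorem colour_inj {e e' : Fin (m + 2) → Bool → Bool} {v v' : Fin (m + 1) → Bool}
    (h0 : e 0 = e' 0) (hm : e (Fin.last (m + 1)) = e' (Fin.last (m + 1)))
    (h : colour e v = colour e' v') : e = e' ∧ v = v' := by
  refine ⟨funext fun i => ?_, funext fun i => congrFun h (vert i true)⟩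
  induction i using Fin.cases with
  | zero => exact h0
  | succ i =>
    induction i using Fin.lastCases with
    | last => exact hm
    | cast i => exact funext fun r => congrFun h (right i r)

theorem exists_colour_eq {f : LadderPoint m → Bool} (h : ∀ p, f ((ladderMap m).α p) = f p)
    (a b : Bool → Bool) : ∃ e v, e 0 = a ∧ e (Fin.last (m + 1)) = b ∧ colour e v = f := by
  refine ⟨Fin.cons a (Fin.snoc (fun i r => f (right i r)) b : Fin (m + 1) → Bool → Bool),
    fun i => f (vert i true), rfl, ?_, ?_⟩
  · rw [← Fin.succ_last, Fin.cons_succ, Fin.snoc_last]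
  · funext p
    rcases p with ⟨i, _ | _⟩ | ⟨i, r⟩ | ⟨i, r⟩
    · exact h (vert i false)
    · rfl
    · simp [colour]
    · exact (by simp [colour] : _ = f (right i r)).trans (h (left i r))

theorem two_pow_numComponents_assemble {s : Fin (m + 1) → Column} (hs : FixesEnds s) :
    2 ^ (HypermapCollection.mk (ladderMap m).α (assemble s hs)).numComponents =
      numColourings s fun _ => true := by
  rw [HypermapCollection.two_pow_numComponents]
  refine (Nat.card_congr (Equiv.ofBijective (fun x => ⟨colour x.1.1 x.1.2,
    colour_ladderMap_α _ _, (colour_assemble_iff hs).2 x.2.1⟩) ⟨?_, ?_⟩)).symm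
  · rintro ⟨x, hx, h0, hm⟩ ⟨y, hy, h0', hm'⟩ h
    obtain ⟨he, hv⟩ := colour_inj (h0.trans h0'.symm) (hm.trans hm'.symm) (congrArg (·.1) h)
    exact Subtype.ext (Prod.ext he hv)
  · rintro ⟨f, hα, hθ⟩
    obtain ⟨e, v, h0, hm, rfl⟩ := exists_colour_eq hα (fun _ => true) (fun _ => true)
    exact ⟨⟨(e, v), (colour_assemble_iff hs).1 hθ, h0, hm⟩, rfl⟩

end Components

section Forests

open scoped Matrix

/-- The ways in which the edges leaving a forest of columns on the right are linked: before the
first column they carry the fixed colour `true`; afterwards they belong to one component or to two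
components. -/
inductive Link
  | start
  | joined
  | separate
  deriving DecidableEq

namespace Link

instance : Fintype Link where
  elems := {start, joined, separate}
  complete x := by cases x <;> decide

/-- The number of colourings of a linked forest by the colours of the two leaving edges. -/
def weight : Link → (Bool → Bool) → ℕ
  | start => fun q => if q = fun _ => true then 1 else 0
  | joined => fun q => if q true = q false then 1 else 0
  | separate => fun _ => 1

/-- The number of components whose colour is free. -/
def components : Link → ℕ
  | start => 0
  | joined => 1
  | separate => 2

theorem weight_injective : Function.Injective weight := by
  intro x y
  revert x y
  decide

theorem sum_eq (f : Link → ℕ) : ∑ x, f x = f start + f joined + f separate := by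
  change ∑ x ∈ {start, joined, separate}, f x = _
  simp [add_assoc]

end Link

/-- A lower bound for the number of colourings of a strip that has a component, free to be coloured
in two ways, without leaving edges. -/
def detachedWeight (q : Bool → Bool) : ℕ :=
  if q = fun _ => true then 2 else if q = fun _ => false then 1 else 0

theorem not_detachedWeight_le_weight (x : Link) : ¬ detachedWeight ≤ x.weight := by
  simp only [Pi.le_def]
  revert x
  decide

theorem detachedWeight_le_vecMul (c : Column) :
    detachedWeight ≤ detachedWeight ᵥ* transferMatrix c := by
  rw [Pi.le_def]
  revert c
  decide +kernel

theorem three_le_detachedWeight_vecMul {c : Column} (h : ∀ r, c r 2 = 2) :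
    3 ≤ (detachedWeight ᵥ* transferMatrix c) fun _ => true := by
  revert c
  decide +kernel

theorem exists_weight_eq_or_detachedWeight_le (x : Link) (c : Column)
    (h : x = Link.start → ∀ r, c r 0 = 0) :
    (∃ y : Link, y ≠ Link.start ∧ x.weight ᵥ* transferMatrix c = y.weight ∧
      columnCycles c + x.components ≤ 3 + y.components) ∨
    detachedWeight ≤ x.weight ᵥ* transferMatrix c := by
  rw [Pi.le_def]
  revert x c
  decide +kernel

theorem columnCycles_add_components_le (x : Link) (c : Column)
    (h : x = Link.start → ∀ r, c r 0 = 0) (h2 : ∀ r, c r 2 = 2)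
    (hx : (x.weight ᵥ* transferMatrix c) (fun _ => true) = 2) :
    columnCycles c + x.components ≤ 6 := by
  revert x c
  decide +kernel

/-- The left directions missing in the first column of a ladder are fixed. -/
def FixesStart {k : ℕ} (s : Fin k → Column) : Prop := ∀ i : Fin k, i.val = 0 → ∀ r, s i r 0 = 0

theorem fixesEnds_iff_fixesStart {s : Fin (m + 1) → Column} :
    FixesEnds s ↔ FixesStart s ∧ ∀ r, s (Fin.last m) r 2 = 2 := by
  rw [FixesEnds, forall_and, and_congr_left_iff]
  refine fun _ => ⟨fun h i hi => ?_, fun h => h 0 rfl⟩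
  rwa [show i = 0 from Fin.ext hi]

theorem fixesStart_snoc_iff {k : ℕ} {s : Fin k → Column} {c : Column} :
    FixesStart (Fin.snoc s c : Fin (k + 1) → Column) ↔
      FixesStart s ∧ (k = 0 → ∀ r, c r 0 = 0) := by
  simp only [FixesStart, Fin.forall_fin_succ', Fin.snoc_castSucc, Fin.snoc_last, Fin.val_castSucc,
    Fin.val_last]

theorem numColourings_eq_weight_start (s : Fin 0 → Column) :
    numColourings s = Link.start.weight := by
  funext q
  simp only [numColourings, Link.weight]
  split_ifs with hq
  · refine Nat.card_eq_one_iff_exists.2 ⟨⟨(fun _ _ => true, Fin.elim0), fun i => i.elim0, rfl,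
      hq.symm⟩, fun x => Subtype.ext (Prod.ext (funext fun i => ?_) (Subsingleton.elim _ _))⟩
    rw [Fin.fin_one_eq_zero i, x.2.2.1]
  · exact Nat.card_eq_zero.2 (.inl ⟨fun x => hq (x.2.2.2.symm.trans x.2.2.1)⟩)

theorem exists_numColourings_eq_weight_or_detachedWeight_le {k : ℕ} {s : Fin k → Column}
    (hs : FixesStart s) :
    (∃ x : Link, (x = Link.start → k = 0) ∧ numColourings s = x.weight ∧
      ∑ i, columnCycles (s i) ≤ 3 * k + x.components) ∨ detachedWeight ≤ numColourings s := by
  induction s using Fin.snocInduction with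
  | elim0 => exact .inl ⟨.start, fun _ => rfl, numColourings_eq_weight_start _, Nat.zero_le _⟩
  | snoc s c ih =>
    obtain ⟨hs, hc⟩ := fixesStart_snoc_iff.1 hs
    rw [numColourings_snoc]
    obtain ⟨x, hx, hN, hle⟩ | hN := ih hs
    · rw [hN]
      refine (exists_weight_eq_or_detachedWeight_le x c fun h => hc (hx h)).imp_left ?_
      rintro ⟨y, hy, hyc, hle'⟩
      refine ⟨y, fun h => absurd h hy, hyc, ?_⟩
      simp only [Fin.sum_univ_castSucc, Fin.snoc_castSucc, Fin.snoc_last]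
      lia
    · exact .inr ((detachedWeight_le_vecMul c).trans (vecMul_mono hN _))

/-- The columns `s` are those of a planar forest every component of which contains an edge leaving
on the right, these edges being linked as in `x`. The last condition is Euler's relation. -/
def IsForest {k : ℕ} (s : Fin k → Column) (x : Link) : Prop :=
  FixesStart s ∧ (∀ i, IsRefining (s i)) ∧ numColourings s = x.weight ∧
    ∑ i, columnCycles (s i) = 3 * k + x.components

/-- The column `c` extends forests linked as in `x` to forests linked as in `y`. -/
def ExtendsForest (x y : Link) (c : Column) : Prop :=
  (x = Link.start → ∀ r, c r 0 = 0) ∧ IsRefining c ∧ x.weight ᵥ* transferMatrix c = y.weight ∧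
    columnCycles c + x.components = 3 + y.components

/-- The columns `s` are those of a spanning hypertree of the reciprocal of the ladder. -/
def IsTree (s : Fin (m + 1) → Column) : Prop :=
  FixesEnds s ∧ (∀ i, IsRefining (s i)) ∧ numColourings s (fun _ => true) = 2 ∧
    ∑ i, columnCycles (s i) = 3 * m + 6

/-- The column `c` completes forests linked as in `x` to trees. -/
def CompletesForest (x : Link) (c : Column) : Prop :=
  (x = Link.start → ∀ r, c r 0 = 0) ∧ (∀ r, c r 2 = 2) ∧ IsRefining c ∧
    (x.weight ᵥ* transferMatrix c) (fun _ => true) = 2 ∧ columnCycles c + x.components = 6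

theorem IsForest.eq_start_of_eq_zero {k : ℕ} {s : Fin k → Column} {x : Link} (h : IsForest s x)
    (hk : k = 0) : x = Link.start := by
  subst hk
  exact Link.weight_injective (h.2.2.1.symm.trans (numColourings_eq_weight_start s))

theorem isForest_snoc_iff {k : ℕ} {s : Fin k → Column} {c : Column} {y : Link} :
    IsForest (Fin.snoc s c : Fin (k + 1) → Column) y ↔ ∃ x, IsForest s x ∧ ExtendsForest x y c := by
  constructor
  · simp only [IsForest, fixesStart_snoc_iff, numColourings_snoc, Fin.sum_univ_castSucc,
      Fin.forall_fin_succ', Fin.snoc_castSucc, Fin.snoc_last]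
    rintro ⟨⟨hs, hc⟩, ⟨hrs, hrc⟩, hN, hsum⟩
    obtain ⟨x, hx, hNx, hle⟩ | hNs := exists_numColourings_eq_weight_or_detachedWeight_le hs
    · rw [hNx] at hN
      obtain ⟨y', -, hy', hle'⟩ | hd := exists_weight_eq_or_detachedWeight_le x c fun h => hc (hx h)
      · obtain rfl := Link.weight_injective (hy'.symm.trans hN)
        exact ⟨x, ⟨hs, hrs, hNx, by lia⟩, fun h => hc (hx h), hrc, hN, by lia⟩
      · exact absurd (hN ▸ hd) (not_detachedWeight_le_weight y)
    · exact absurd (hN ▸ (detachedWeight_le_vecMul c).trans (vecMul_mono hNs _))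
        (not_detachedWeight_le_weight y)
  · rintro ⟨x, hs, hc, hrc, hN, hsum⟩
    have hk : FixesStart s ∧ (k = 0 → ∀ r, c r 0 = 0) :=
      ⟨hs.1, fun hk => hc (hs.eq_start_of_eq_zero hk)⟩
    simp only [IsForest, fixesStart_snoc_iff, numColourings_snoc, Fin.sum_univ_castSucc,
      Fin.forall_fin_succ', Fin.snoc_castSucc, Fin.snoc_last]
    exact ⟨hk, ⟨hs.2.1, hrc⟩, hs.2.2.1 ▸ hN, by have := hs.2.2.2; lia⟩

theorem isTree_snoc_iff {s : Fin m → Column} {c : Column} :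
    IsTree (Fin.snoc s c : Fin (m + 1) → Column) ↔ ∃ x, IsForest s x ∧ CompletesForest x c := by
  constructor
  · simp only [IsTree, fixesEnds_iff_fixesStart, fixesStart_snoc_iff, numColourings_snoc,
      Fin.sum_univ_castSucc, Fin.forall_fin_succ', Fin.snoc_castSucc, Fin.snoc_last]
    rintro ⟨⟨⟨hs, hc⟩, hc2⟩, ⟨hrs, hrc⟩, hN, hsum⟩
    obtain ⟨x, hx, hNx, hle⟩ | hNs := exists_numColourings_eq_weight_or_detachedWeight_le hs
    · rw [hNx] at hN
      have hle' := columnCycles_add_components_le x c (fun h => hc (hx h)) hc2 hN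
      exact ⟨x, ⟨hs, hrs, hNx, by lia⟩, fun h => hc (hx h), hc2, hrc, hN, by lia⟩
    · have h3 := (three_le_detachedWeight_vecMul hc2).trans (vecMul_mono hNs _ _)
      exact absurd hN (by lia)
  · rintro ⟨x, hs, hc, hc2, hrc, hN, hsum⟩
    have hk : FixesStart s ∧ (m = 0 → ∀ r, c r 0 = 0) :=
      ⟨hs.1, fun hm => hc (hs.eq_start_of_eq_zero hm)⟩
    simp only [IsTree, fixesEnds_iff_fixesStart, fixesStart_snoc_iff, numColourings_snoc,
      Fin.sum_univ_castSucc, Fin.forall_fin_succ', Fin.snoc_castSucc, Fin.snoc_last]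
    exact ⟨⟨hk, hc2⟩, ⟨hs.2.1, hrc⟩, hs.2.2.1 ▸ hN, by have := hs.2.2.2; lia⟩

end Forests

section Counting

/-- The number of forests on `k` columns by the linkage of the leaving edges. -/
noncomputable def numForests (k : ℕ) (x : Link) : ℕ :=
  Nat.card {s : Fin k → Column // IsForest s x}

theorem IsForest.link_unique {k : ℕ} (s : Fin k → Column) (x y : Link) (hx : IsForest s x)
    (hy : IsForest s y) : x = y :=
  Link.weight_injective (hx.2.2.1.symm.trans hy.2.2.1)

theorem numForests_zero (x : Link) : numForests 0 x = if x = Link.start then 1 else 0 := by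
  split_ifs with hx
  · refine Nat.card_eq_one_iff_exists.2 ⟨⟨Fin.elim0, fun i => i.elim0, fun i => i.elim0, ?_, ?_⟩,
      fun s => Subsingleton.elim _ _⟩
    · rw [hx, numColourings_eq_weight_start]
    · rw [hx, Finset.univ_eq_empty, Finset.sum_empty]
      rfl
  · exact Nat.card_eq_zero.2 (.inl ⟨fun s => hx (s.2.eq_start_of_eq_zero rfl)⟩)

theorem numForests_succ (k : ℕ) (y : Link) :
    numForests (k + 1) y = ∑ x, numForests k x * Nat.card {c // ExtendsForest x y c} :=
  card_snoc IsForest.link_unique fun _ _ => isForest_snoc_iff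

theorem card_isTree (m : ℕ) : Nat.card {s : Fin (m + 1) → Column // IsTree s} =
    ∑ x, numForests m x * Nat.card {c // CompletesForest x c} :=
  card_snoc IsForest.link_unique fun _ _ => isTree_snoc_iff

instance (c : Column) : Decidable (IsRefining c) := inferInstanceAs (Decidable (∀ _, _))

instance (x y : Link) (c : Column) : Decidable (ExtendsForest x y c) :=
  inferInstanceAs (Decidable (_ ∧ _))

instance (x : Link) (c : Column) : Decidable (CompletesForest x c) :=
  inferInstanceAs (Decidable (_ ∧ _))

theorem card_extendsForest (x y : Link) : Nat.card {c // ExtendsForest x y c} =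
    match x, y with
    | .start, .joined => 1
    | .start, .separate => 2
    | .joined, .joined => 4
    | .joined, .separate => 8
    | .separate, .joined => 1
    | .separate, .separate => 4
    | _, .start => 0 := by
  rw [Nat.card_eq_fintype_card]
  revert x y
  decide +kernel

theorem numForests_start_succ (k : ℕ) : numForests (k + 1) .start = 0 := by
  simp only [numForests_succ, card_extendsForest, mul_zero, Finset.sum_const_zero]

theorem numForests_joined_succ (k : ℕ) : numForests (k + 1) .joined =
    numForests k .start + 4 * numForests k .joined + numForests k .separate := by
  rw [numForests_succ, Link.sum_eq]
  simp only [card_extendsForest]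
  ring

theorem numForests_separate_succ (k : ℕ) : numForests (k + 1) .separate =
    2 * numForests k .start + 8 * numForests k .joined + 4 * numForests k .separate := by
  rw [numForests_succ, Link.sum_eq]
  simp only [card_extendsForest]
  ring

theorem card_completesForest (x : Link) : Nat.card {c // CompletesForest x c} =
    match x with
    | .start => 1
    | .joined => 2
    | .separate => 1 := by
  rw [Nat.card_eq_fintype_card]
  revert x
  decide +kernel

theorem isSpanningHypertree_assemble_iff {s : Fin (m + 1) → Column} (hs : FixesEnds s) :
    (ladderMap m).reciprocal.IsSpanningHypertree (assemble s hs) ↔ IsTree s := by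
  let H := HypermapCollection.mk (ladderMap m).α (assemble s hs)
  have isHypermap_iff : H.numComponents = 1 ↔ numColourings s (fun _ => true) = 2 := by
    rw [← two_pow_numComponents_assemble hs]
    exact (Nat.pow_eq_self_iff one_lt_two).symm
  have faces_genus_iff (h : H.numComponents = 1) :
      H.numFaces = 1 ∧ H.genus = 0 ↔ ∑ i, columnCycles (s i) = 3 * m + 6 := by
    have hH := H.numFaces_eq_numComponents_and_genus_eq_zero_iff
    rw [h, card_eq, numCycles_ladderMap_α] at hH
    rw [hH, ← numCycles_assemble_add_four hs]
    lia
  rw [IsTree, ← isHypermap_iff, ← isRefinement_assemble_iff hs]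
  exact ⟨fun ⟨hr, hκ, h⟩ => ⟨hs, hr, hκ, (faces_genus_iff hκ).1 h⟩,
    fun ⟨_, hr, hκ, h⟩ => ⟨hr, hκ, (faces_genus_iff hκ).2 h⟩⟩

theorem numSpanningHypertrees_eq_card_isTree (m : ℕ) :
    (ladderMap m).reciprocal.numSpanningHypertrees =
      Nat.card {s : Fin (m + 1) → Column // IsTree s} := by
  refine (Nat.card_congr (Equiv.ofBijective (fun s => ⟨assemble s.1 s.2.1,
    (isSpanningHypertree_assemble_iff s.2.1).2 s.2⟩) ⟨fun s t h => ?_, fun ⟨θ, hθ⟩ => ?_⟩)).symm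
  · exact Subtype.ext (assemble_injective s.2.1 t.2.1 (congrArg Subtype.val h))
  · obtain ⟨s, hs, rfl⟩ := exists_assemble_eq_of_isRefinement hθ.1
    exact ⟨⟨s, (isSpanningHypertree_assemble_iff hs).1 hθ⟩, rfl⟩

theorem numSpanningHypertrees_reciprocal_ladderMap (m : ℕ) :
    (ladderMap m).reciprocal.numSpanningHypertrees =
      numForests m .start + 2 * numForests m .joined + numForests m .separate := by
  rw [numSpanningHypertrees_eq_card_isTree, card_isTree, Link.sum_eq]
  simp only [card_completesForest]
  ring

end Counting

section GeneratingFunction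

open PowerSeries

/-- The generating function of the forests by the number of columns. -/
noncomputable def forestSeries (x : Link) : ℚ⟦X⟧ := PowerSeries.mk fun k => (numForests k x : ℚ)

theorem forestSeries_start : forestSeries .start = 1 := by
  ext (_ | n)
  · simp [forestSeries, numForests_zero]
  · simp [forestSeries, numForests_start_succ, coeff_one]

theorem forestSeries_joined : forestSeries .joined =
    X * (forestSeries .start + 4 * forestSeries .joined + forestSeries .separate) := by
  ext (_ | n)
  · simp [forestSeries, numForests_zero]
  · simp [forestSeries, numForests_joined_succ, coeff_succ_X_mul,
      ← map_ofNat (C (R := ℚ))]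

theorem forestSeries_separate : forestSeries .separate =
    X * (2 * forestSeries .start + 8 * forestSeries .joined + 4 * forestSeries .separate) := by
  ext (_ | n)
  · simp [forestSeries, numForests_zero]
  · simp [forestSeries, numForests_separate_succ, coeff_succ_X_mul,
      ← map_ofNat (C (R := ℚ))]

theorem mk_numSpanningHypertrees :
    PowerSeries.mk (fun m => ((ladderMap m).reciprocal.numSpanningHypertrees : ℚ)) =
      forestSeries .start + 2 * forestSeries .joined + forestSeries .separate := by
  ext n
  simp [forestSeries, numSpanningHypertrees_reciprocal_ladderMap, ← map_ofNat (C (R := ℚ))]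

end GeneratingFunction

end LadderPoint

theorem mainTheorem4 :
    PowerSeries.mk (fun m : ℕ => ((ladderMap m).reciprocal.numSpanningHypertrees : ℚ)) =
      (1 - 2 * PowerSeries.X) ^ 2 * (1 - 8 * PowerSeries.X + 8 * PowerSeries.X ^ 2)⁻¹ := by
  rw [PowerSeries.eq_mul_inv_iff_mul_eq (by simp), LadderPoint.mk_numSpanningHypertrees]
  have hJ := LadderPoint.forestSeries_joined
  have hS := LadderPoint.forestSeries_separate
  rw [LadderPoint.forestSeries_start] at hJ hS ⊢
  linear_combination 2 * hJ + (1 - 2 * PowerSeries.X) * hS
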